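/- For a subset $S$ of a group $G$, let $\langle S\rangle^G_1$ be the normal closure of $S$ in $G$ and, for $\ell\ge 2$, let $\langle S\rangle^G_\ell$ (the $\ell$-subnormal closure of $S$ in $G$) be the normal closure of $S$ in the group $\langle S\rangle^G_{\ell-1}$. Let $F$ be a free group (of arbitrary rank) with free basis $X$, let $|h|$ denote the length of the reduced word over $X^{\pm1}$ representing $h\in F$, and let $g\in F$. Then: (1) $\bigcap_{\ell=1}^{\infty}\langle g\rangle^F_\ell=\langle g\rangle$, the cyclic subgroup generated by $g$. (2) For $\ell\ge 1$ let $D(g,\ell)=\min\{|h| : h\in\langle g\rangle^F_\ell\setminus\langle g\rangle\}$, with $D(g,\ell)=\infty$ if this set is empty. Then there is a constant $c>0$ (which may depend on $g$, $F$ and $X$, but not on $\ell$) such that $D(g,\ell)\ge c\,2^\ell$ for every $\ell\ge 1$. -/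

import Mathlib

/-- For a set `S` contained in a subgroup `H` of `G`, the normal closure of `S` in `H`
(the smallest normal subgroup of `H` containing `S`), viewed as a subgroup of `G`. -/
def normalClosureIn {G : Type*} [Group G] (S : Set G) (H : Subgroup G) : Subgroup G :=
  (Subgroup.normalClosure ((fun x : H => (x : G)) ⁻¹' S)).map H.subtype

/-- The `ℓ`-subnormal closure of `S` in `G`: start with `G` itself at `ℓ = 0`; the
`(ℓ + 1)`-subnormal closure is the normal closure of `S` in the `ℓ`-subnormal closure. -/
def subnormalClosure {G : Type*} [Group G] (S : Set G) : ℕ → Subgroup G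
  | 0 => ⊤
  | ℓ + 1 => normalClosureIn S (subnormalClosure S ℓ)

/-- `S` lies in each of its subnormal closures, so that the recursion above is meaningful. -/
theorem subset_subnormalClosure {G : Type*} [Group G] (S : Set G) (ℓ : ℕ) :
    S ⊆ subnormalClosure S ℓ := by
  induction ℓ with
  | zero => exact fun x _ => Subgroup.mem_top x
  | succ ℓ ih =>
    intro x hx
    exact ⟨⟨x, ih hx⟩, Subgroup.subset_normalClosure hx, rfl⟩

/-- The `1`-subnormal closure is the ordinary normal closure. -/
theorem subnormalClosure_one {G : Type*} [Group G] (S : Set G) :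
    subnormalClosure S 1 = Subgroup.normalClosure S := by
  apply le_antisymm
  · refine Subgroup.map_le_iff_le_comap.2 (Subgroup.normalClosure_le_normal ?_)
    exact fun x hx => Subgroup.subset_normalClosure hx
  · have hn : (subnormalClosure S 1).Normal :=
      Subgroup.normalClosure_normal.map (⊤ : Subgroup G).subtype
        (fun x => ⟨⟨x, Subgroup.mem_top x⟩, rfl⟩)
    exact Subgroup.normalClosure_le_normal (subset_subnormalClosure S 1)

open Classical in
/-- The length `|h|` of an element `h` of a free group with respect to the free basis `b`:
the length of the reduced word over the basis that represents `h`. -/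
noncomputable def basisLength {ι F : Type*} [Group F] (b : FreeGroupBasis ι F) (h : F) : ℕ :=
  (b.repr h).norm

/-- `D(g, ℓ)`: the minimum of the lengths of the elements of the `ℓ`-subnormal closure of `g`
lying outside `⟨g⟩`; it is `⊤` (infinity) if there are no such elements. -/
noncomputable def minLengthOutside {ι F : Type*} [Group F] (b : FreeGroupBasis ι F)
    (g : F) (ℓ : ℕ) : ℕ∞ :=
  ⨅ h ∈ (subnormalClosure {g} ℓ : Set F) \ (Subgroup.zpowers g : Set F), (basisLength b h : ℕ∞)

/-!
The proof has two independent halves, both about `F = FreeGroup ι`; the basis `b` transports them.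

*Short elements are absorbed.* Let `D_n` be the subgroup of those elements of `F` whose Magnus
series is `1` modulo degree `n`. Since `[F, D_n] ≤ D_{n+1}`, induction on `ℓ` places the
`ℓ`-subnormal closure of `g` inside `⟨g⟩ D_{ℓ+1}`. If `h` lies in this closure and is short compared
with `ℓ`, then the commutator of `h` and `g` is short and lies in `D_{ℓ+2}`. It is trivial, because
a nontrivial reduced word of length `m` has a nonzero Magnus coefficient in some degree between `1`
and `m`. Commuting elements of a free group are powers of a common `r`, and as `F / D_{ℓ+1}` is
torsion-free, `h ∈ ⟨g⟩ D_{ℓ+1}` forces `h ∈ ⟨g⟩` (`WordSeries.mem_zpowers_of_norm_le`).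

*Lengths double.* Let `H` contain `g`, let every element of `H` outside `⟨g⟩` have length at least
`D > 2|g|`, and let `h` be in the normal closure of `g` in `H`, but not in `⟨g⟩`. In the Schreier
graph of `H`, collapse the image of the ball of radius `|g|`, which contains the loop spelled by
`g`. The loop spelled by `h` becomes contractible. If its partial paths were contractible in the
collapsed graph whenever they visit the collapsed part, then the loop could never leave that part,
because its word is reduced; and a loop within the collapsed part spells an element of `⟨g⟩`, since
elements of `H` of length at most `2|g|` lie there. So at some visit the partial path is not
contractible. Closing it up inside the ball writes `h` as a product of two elements of `H` outside
`⟨g⟩`, whence `|h| ≥ 2D - 2|g|` (`FreeGroup.two_mul_le_norm_of_mem_normalClosureIn`).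

Together, the shortest elements outside `⟨g⟩` eventually have length more than `2|g|`, and from then
on the excess over `2|g|` doubles at every step. This exponential bound also gives the
intersection.
-/

/-! ### Subnormal closures and commuting elements -/

theorem normalClosureIn_le {G : Type*} [Group G] {S : Set G} {H N : Subgroup G}
    (hS : S ∩ H ⊆ N) (hN : ∀ a ∈ H, ∀ n ∈ N, a * n * a⁻¹ ∈ N) : normalClosureIn S H ≤ N := by
  have : (N.comap H.subtype).Normal := ⟨fun n hn a => hN a a.2 n hn⟩
  exact Subgroup.map_le_iff_le_comap.2
    (Subgroup.normalClosure_le_normal fun x hx => hS ⟨hx, x.2⟩)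

theorem conj_mem_normalClosureIn {G : Type*} [Group G] {S : Set G} {H : Subgroup G} {a n : G}
    (ha : a ∈ H) (hn : n ∈ normalClosureIn S H) : a * n * a⁻¹ ∈ normalClosureIn S H := by
  obtain ⟨m, hm, rfl⟩ := hn
  exact ⟨_, Subgroup.normalClosure_normal.conj_mem m hm ⟨a, ha⟩, rfl⟩

theorem normalClosureIn_le_self {G : Type*} [Group G] (S : Set G) (H : Subgroup G) :
    normalClosureIn S H ≤ H :=
  normalClosureIn_le Set.inter_subset_right
    fun _ ha _ hn => mul_mem (mul_mem ha hn) (inv_mem ha)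

theorem map_mem_subnormalClosure {G K : Type*} [Group G] [Group K] (f : G →* K) (g : G) (ℓ : ℕ) :
    ∀ h ∈ subnormalClosure {g} ℓ, f h ∈ subnormalClosure {f g} ℓ := by
  induction ℓ with
  | zero => exact fun _ _ => Subgroup.mem_top _
  | succ ℓ ih =>
    refine normalClosureIn_le (N := (subnormalClosure {f g} (ℓ + 1)).comap f) ?_ ?_
    · rintro x ⟨rfl, -⟩
      exact subset_subnormalClosure {f x} (ℓ + 1) rfl
    · intro a ha n hn
      rw [Subgroup.mem_comap, map_mul, map_mul, map_inv]
      exact conj_mem_normalClosureIn (ih a ha) hn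

theorem zpowers_le_subnormalClosure {G : Type*} [Group G] (g : G) (ℓ : ℕ) :
    Subgroup.zpowers g ≤ subnormalClosure {g} ℓ :=
  Subgroup.zpowers_le.2 (subset_subnormalClosure {g} ℓ rfl)

namespace FreeGroup

theorem mk_ne_one_of_isReduced_cons {α : Type*} {a : α × Bool} {L : List (α × Bool)}
    (h : IsReduced (a :: L)) : mk (a :: L) ≠ 1 := by
  classical
  intro h1
  have := congrArg toWord h1
  rw [toWord_mk, h.reduce_eq] at this
  simp at this

theorem eq_of_commute_of {α : Type*} {a b : α} (h : Commute (of a) (of b)) : a = b := by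
  by_contra hab
  refine mk_ne_one_of_isReduced_cons (a := (a, true)) (L := [(b, true), (a, false), (b, false)])
    ?_ ?_
  · simp [hab, Ne.symm hab]
  · have : of a * of b * (of a)⁻¹ * (of b)⁻¹ = 1 := by
      rw [h.eq]; group
    simpa [of, invRev] using this

/-- Two commuting elements of a free group are powers of a common element: the subgroup they
generate is free by the Nielsen–Schreier theorem, and abelian, hence of rank at most one. -/
theorem exists_zpow_of_commute {α : Type*} {g h : FreeGroup α} (hc : Commute g h) :
    ∃ r : FreeGroup α, g ∈ Subgroup.zpowers r ∧ h ∈ Subgroup.zpowers r := by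
  let A := Subgroup.closure {g, h}
  have hA : ∀ a b : A, a * b = b * a := by
    have : IsMulCommutative A := by
      refine Subgroup.isMulCommutative_closure ?_
      rintro x (rfl | rfl) y (rfl | rfl)
      exacts [rfl, hc.eq, hc.eq.symm, rfl]
    exact fun a b => mul_comm' a b
  let e := IsFreeGroup.toFreeGroup A
  have hs : Subsingleton (IsFreeGroup.Generators A) :=
    ⟨fun a b => eq_of_commute_of <| e.symm.injective (by simpa using hA _ _)⟩
  have hcyc : IsCyclic A := by
    have : IsCyclic (FreeGroup (IsFreeGroup.Generators A)) := by
      rcases isEmpty_or_nonempty (IsFreeGroup.Generators A) with h0 | ⟨⟨x⟩⟩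
      · infer_instance
      · have := uniqueOfSubsingleton x
        infer_instance
    exact isCyclic_of_surjective e.symm e.symm.surjective
  obtain ⟨r, hr⟩ := hcyc.exists_generator
  have key : ∀ x ∈ A, x ∈ Subgroup.zpowers (r : FreeGroup α) := by
    intro x hx
    obtain ⟨n, hn⟩ := hr ⟨x, hx⟩
    exact ⟨n, by simpa using congrArg Subtype.val hn⟩
  exact ⟨r, key g (Subgroup.subset_closure (by simp)), key h (Subgroup.subset_closure (by simp))⟩

end FreeGroup

/-! ### Collapsed Schreier graphs and the doubling of lengths -/

namespace FreeGroup

variable {ι : Type*}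

/-- Any labelling of the edges of the Schreier graph of an action of a free group extends to a
cocycle: `θ a c` is the product of the labels along the path from `c` to `a • c` spelled by `a`. -/
theorem exists_cocycle {Q K : Type*} [Group K] [MulAction (FreeGroup ι) Q] (lab : Q → ι → K) :
    ∃ θ : FreeGroup ι → Q → K,
      (∀ a b c, θ (a * b) c = θ a (b • c) * θ b c) ∧ ∀ x c, θ (of x) c = lab c x := by
  let _ : MulDistribMulAction (FreeGroup ι) (Q → K) := arrowMulDistribMulAction
  let σ : FreeGroup ι →* (Q → K) ⋊[MulDistribMulAction.toMulAut (FreeGroup ι) (Q → K)] FreeGroup ι :=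
    lift fun x => ⟨fun c => lab ((of x)⁻¹ • c) x, of x⟩
  have hr : ∀ a, (σ a).right = a := by
    intro a
    exact DFunLike.congr_fun
      (FreeGroup.ext_hom (SemidirectProduct.rightHom.comp σ) (MonoidHom.id _) (by simp [σ])) a
  refine ⟨fun a c => (σ a).left (a • c), fun a b c => ?_, fun x c => by simp [σ]⟩
  have h : ((MulDistribMulAction.toMulAut (FreeGroup ι) (Q → K)) a (σ b).left) ((a * b) • c) =
      (σ b).left (b • c) := by
    change (σ b).left (a⁻¹ • (a * b) • c) = _
    rw [smul_smul, inv_mul_cancel_left]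
  have h' : σ (a * b) = σ a * σ b := MonoidHom.map_mul σ a b
  dsimp only
  rw [h', SemidirectProduct.mul_left, hr, Pi.mul_apply, h, mul_smul]

/-- The edge of the Schreier graph traversed by the letter `(x, b)` on its way to the vertex `c`.
An edge is named by its origin and its label, whichever way it is traversed. As words act from the
left, a path reads its word from the right, and the first letter of the word is its last step. -/
def lastEdge {Q : Type*} [MulAction (FreeGroup ι) Q] (x : ι) (b : Bool) (c : Q) : Q × ι :=
  (if b then (of x)⁻¹ • c else c, x)

variable [DecidableEq ι]

/-- `θ` is the cocycle on the Schreier graph of `H` that labels each edge by itself, except that the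
edges in the image of the ball of radius `R` of the Cayley graph are labelled by `1`. Thus `θ a c`
is the homotopy class of the path from `c` spelled by `a`, after that image is collapsed. -/
structure IsCollapse (H : Subgroup (FreeGroup ι)) (R : ℕ)
    (θ : FreeGroup ι → FreeGroup ι ⧸ H → FreeGroup ((FreeGroup ι ⧸ H) × ι)) : Prop where
  intro ::
  cocycle : ∀ a b c, θ (a * b) c = θ a (b • c) * θ b c
  collapsed : ∀ x (p : FreeGroup ι), p.norm ≤ R → (of x * p).norm ≤ R → θ (of x) p = 1
  edge : ∀ x (c : FreeGroup ι ⧸ H), (∀ p : FreeGroup ι, p.norm ≤ R → (of x * p).norm ≤ R → c ≠ p) →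
    θ (of x) c = of (c, x)

theorem exists_isCollapse (H : Subgroup (FreeGroup ι)) (R : ℕ) : ∃ θ, IsCollapse H R θ := by
  classical
  obtain ⟨θ, h1, h2⟩ := exists_cocycle (ι := ι) (Q := FreeGroup ι ⧸ H) fun c x =>
    if ∀ p : FreeGroup ι, p.norm ≤ R → (of x * p).norm ≤ R → c ≠ p then of (c, x) else 1
  refine ⟨θ, h1, fun x p hp hxp => ?_, fun x c hc => ?_⟩
  · rw [h2, if_neg]
    exact fun h => h p hp hxp rfl
  · rw [h2, if_pos hc]

namespace IsCollapse

variable {H : Subgroup (FreeGroup ι)} {R : ℕ}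
  {θ : FreeGroup ι → FreeGroup ι ⧸ H → FreeGroup ((FreeGroup ι ⧸ H) × ι)}

theorem one (h : IsCollapse H R θ) (c : FreeGroup ι ⧸ H) : θ 1 c = 1 := by
  have := h.cocycle 1 1 c
  simpa using this

theorem inv (h : IsCollapse H R θ) (a : FreeGroup ι) (c : FreeGroup ι ⧸ H) :
    θ a⁻¹ c = (θ a (a⁻¹ • c))⁻¹ := by
  have := h.cocycle a a⁻¹ c
  rw [mul_inv_cancel, h.one] at this
  exact eq_inv_of_mul_eq_one_right this.symm

theorem mul_coe (h : IsCollapse H R θ) (a b : FreeGroup ι) :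
    θ (a * b) (1 : FreeGroup ι) = θ a b * θ b (1 : FreeGroup ι) := by
  rw [h.cocycle]
  congr 2
  simp

theorem mul_of_mem (h : IsCollapse H R θ) (a : FreeGroup ι) {b : FreeGroup ι} (hb : b ∈ H) :
    θ (a * b) (1 : FreeGroup ι) = θ a (1 : FreeGroup ι) * θ b (1 : FreeGroup ι) := by
  rw [h.mul_coe]
  have hc : ((1 : FreeGroup ι) : FreeGroup ι ⧸ H) = b := QuotientGroup.eq.2 (by simpa using hb)
  rw [hc]

/-- A letter either traverses an edge in the image of the ball, or contributes that edge. -/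
theorem letter (h : IsCollapse H R θ) (x : ι) (b : Bool) (q : FreeGroup ι) :
    (∃ p : FreeGroup ι, p.norm ≤ R ∧ (mk [(x, b)] * p).norm ≤ R ∧ (q : FreeGroup ι ⧸ H) = p) ∨
    θ (mk [(x, b)]) q = mk [(lastEdge x b ((mk [(x, b)] * q : FreeGroup ι) : FreeGroup ι ⧸ H), b)]
      := by
  refine or_iff_not_imp_left.2 fun hn => ?_
  push Not at hn
  cases b
  · change θ (of x)⁻¹ q = _
    rw [h.inv, h.edge]
    · rfl
    · intro p hp hxp hc
      refine hn (of x * p) hxp ?_ ?_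
      · change ((of x)⁻¹ * (of x * p)).norm ≤ R
        simpa using hp
      · have := congrArg (of x • ·) hc
        simpa using this
  · change θ (of x) q = _
    rw [h.edge x q fun p hp hxp => hn p hp hxp]
    change _ = of _
    congr 1
    refine Prod.ext ?_ rfl
    change (q : FreeGroup ι ⧸ H) = (of x)⁻¹ • ((of x * q : FreeGroup ι) : FreeGroup ι ⧸ H)
    change _ = (((of x)⁻¹ * (of x * q) : FreeGroup ι) : FreeGroup ι ⧸ H)
    rw [inv_mul_cancel_left]

theorem letter_collapsed (h : IsCollapse H R θ) (x : ι) (b : Bool) {p : FreeGroup ι}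
    (hp : p.norm ≤ R) (hxp : (mk [(x, b)] * p).norm ≤ R) : θ (mk [(x, b)]) p = 1 := by
  cases b
  · change θ (of x)⁻¹ p = 1
    rw [h.inv, inv_eq_one]
    exact h.collapsed x ((of x)⁻¹ * p) hxp (by simpa using hp)
  · exact h.collapsed x p hp hxp

theorem of_norm_le (h : IsCollapse H R θ) {p : FreeGroup ι} (hp : p.norm ≤ R) :
    θ p (1 : FreeGroup ι) = 1 := by
  have key : ∀ L : List (ι × Bool), L.length ≤ R → θ (mk L) (1 : FreeGroup ι) = 1 := by
    intro L hL
    induction L with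
    | nil => exact h.one _
    | cons a L ih =>
      have hmk : mk (a :: L) = mk [a] * mk L := by rw [mul_mk]; rfl
      have h1 : (mk L).norm ≤ R := norm_mk_le.trans ((Nat.le_succ _).trans hL)
      rw [hmk, h.mul_coe, ih ((Nat.le_succ _).trans hL), mul_one]
      exact h.letter_collapsed a.1 a.2 h1 (hmk ▸ norm_mk_le.trans hL)
  rw [← mk_toWord (x := p)]
  exact key p.toWord hp

/-- Follow the path in the Schreier graph spelled by a reduced word, and suppose that its image in
the collapsed graph is contractible at each visit to the image of the ball. Then the path either
has never left that image, or is now outside of it, its image in the collapsed graph being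
reduced since its last visit. -/
theorem path_dichotomy (h : IsCollapse H R θ) {g : FreeGroup ι} (hg : g ∈ H)
    (hshort : ∀ a ∈ H, a.norm ≤ 2 * R → a ∈ Subgroup.zpowers g) (L : List (ι × Bool))
    (hL : IsReduced L)
    (hvisit : ∀ L', L' <:+ L → ∀ p : FreeGroup ι, p.norm ≤ R → (mk L' : FreeGroup ι ⧸ H) = p →
      θ (mk L') (1 : FreeGroup ι) = 1) :
    (∃ p z, p.norm ≤ R ∧ z ∈ Subgroup.zpowers g ∧ mk L = p * z) ∨
    ((∀ p : FreeGroup ι, p.norm ≤ R → (mk L : FreeGroup ι ⧸ H) ≠ p) ∧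
      ∃ x b L' W, L = (x, b) :: L' ∧ IsReduced ((lastEdge x b (mk L : FreeGroup ι ⧸ H), b) :: W) ∧
        θ (mk L) (1 : FreeGroup ι) = mk ((lastEdge x b (mk L : FreeGroup ι ⧸ H), b) :: W)) := by
  have hgH : Subgroup.zpowers g ≤ H := Subgroup.zpowers_le.2 hg
  induction L with
  | nil => exact Or.inl ⟨1, 1, by simp, one_mem _, by simp [one_eq_mk]⟩
  | cons a L ih =>
    obtain ⟨x, b⟩ := a
    have hmk : mk ((x, b) :: L) = mk [(x, b)] * mk L := by rw [mul_mk]; rfl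
    -- A path with a nontrivial reduced image is away from the ball, by the hypothesis on visits.
    have away : ∀ W, IsReduced ((lastEdge x b (mk ((x, b) :: L) : FreeGroup ι ⧸ H), b) :: W) →
        θ (mk ((x, b) :: L)) (1 : FreeGroup ι) =
          mk ((lastEdge x b (mk ((x, b) :: L) : FreeGroup ι ⧸ H), b) :: W) →
        ∀ p : FreeGroup ι, p.norm ≤ R → (mk ((x, b) :: L) : FreeGroup ι ⧸ H) ≠ p := by
      intro W hW hθ p hp hc
      exact mk_ne_one_of_isReduced_cons hW (hθ ▸ hvisit _ List.suffix_rfl p hp hc)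
    rcases ih (hL.infix (List.suffix_cons _ _).isInfix)
      (fun L' hL' => hvisit L' (hL'.trans (List.suffix_cons _ _))) with
      ⟨p, z, hp, hz, hpz⟩ | ⟨hout, x', b', L', W, rfl, hW, hθ⟩
    · have hc : (mk L : FreeGroup ι ⧸ H) = p := by
        rw [hpz]
        exact (QuotientGroup.eq.2 (by simpa using hgH hz)).symm
      rcases h.letter x b (mk L) with ⟨p', hp', hxp', hc'⟩ | hedge
      · -- Two elements of the ball in the same coset differ by a power of `g`.
        have hz' : p'⁻¹ * p ∈ Subgroup.zpowers g := by
          refine hshort _ (QuotientGroup.eq.1 (hc'.symm.trans hc)) ?_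
          have := norm_mul_le p'⁻¹ p
          rw [norm_inv_eq] at this
          omega
        refine Or.inl ⟨mk [(x, b)] * p', p'⁻¹ * p * z, hxp', mul_mem hz' hz, ?_⟩
        rw [hmk, hpz]
        group
      · have hθ : θ (mk ((x, b) :: L)) (1 : FreeGroup ι) =
            mk [(lastEdge x b (mk ((x, b) :: L) : FreeGroup ι ⧸ H), b)] := by
          rw [hmk, h.mul_coe, hvisit L (List.suffix_cons _ _) p hp hc, mul_one, hedge]
        exact Or.inr ⟨away [] IsReduced.singleton hθ, x, b, L, [], rfl, IsReduced.singleton, hθ⟩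
    · rcases h.letter x b (mk ((x', b') :: L')) with ⟨p', hp', -, hc'⟩ | hedge
      · exact absurd hc' (hout p' hp')
      · have hred := isReduced_cons_cons.1 hL
        have hW' : IsReduced ((lastEdge x b (mk ((x, b) :: (x', b') :: L') : FreeGroup ι ⧸ H), b) ::
            (lastEdge x' b' (mk ((x', b') :: L') : FreeGroup ι ⧸ H), b') :: W) :=
          isReduced_cons_cons.2 ⟨fun he => hred.1 (congrArg Prod.snd he), hW⟩
        have hθ' : θ (mk ((x, b) :: (x', b') :: L')) (1 : FreeGroup ι) =
            mk ((lastEdge x b (mk ((x, b) :: (x', b') :: L') : FreeGroup ι ⧸ H), b) ::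
              (lastEdge x' b' (mk ((x', b') :: L') : FreeGroup ι ⧸ H), b') :: W) := by
          rw [hmk, h.mul_coe, hθ, hedge, mul_mk]
          rfl
        exact Or.inr ⟨away _ hW' hθ', x, b, _, _, rfl, hW', hθ'⟩

end IsCollapse

/-- Passing to the normal closure of `g` doubles the length of the shortest elements outside `⟨g⟩`,
up to an additive constant, as soon as these are longer than `2 * |g|`. -/
theorem two_mul_le_norm_of_mem_normalClosureIn {H : Subgroup (FreeGroup ι)} {g h : FreeGroup ι}
    {D : ℕ} (hg : g ∈ H) (hD : ∀ a ∈ H, a ∉ Subgroup.zpowers g → D ≤ a.norm)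
    (hshort : 2 * g.norm < D) (hh : h ∈ normalClosureIn {g} H) (hhg : h ∉ Subgroup.zpowers g) :
    2 * D ≤ h.norm + 2 * g.norm := by
  obtain ⟨θ, hθ⟩ := exists_isCollapse H g.norm
  have hgH : Subgroup.zpowers g ≤ H := Subgroup.zpowers_le.2 hg
  have hhH : h ∈ H := normalClosureIn_le_self _ _ hh
  have hshort' : ∀ a ∈ H, a.norm ≤ 2 * g.norm → a ∈ Subgroup.zpowers g := by
    intro a ha han
    by_contra hc
    have := hD a ha hc
    omega
  -- On `H`, the cocycle is a homomorphism, which kills `g` and hence its normal closure.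
  let φ : H →* FreeGroup ((FreeGroup ι ⧸ H) × ι) :=
    MonoidHom.mk' (fun a => θ a (1 : FreeGroup ι)) fun a b => hθ.mul_of_mem a b.2
  have hker : ∀ a ∈ normalClosureIn {g} H, θ a (1 : FreeGroup ι) = 1 := by
    rintro _ ⟨a, ha, rfl⟩
    refine (Subgroup.normalClosure_le_normal (N := φ.ker) ?_) ha
    rintro ⟨x, hx⟩ rfl
    exact hθ.of_norm_le le_rfl
  have hzp : ∀ a ∈ Subgroup.zpowers g, θ a (1 : FreeGroup ι) = 1 := fun a ha =>
    hker a (Subgroup.zpowers_le.2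
      (show g ∈ normalClosureIn {g} H from ⟨⟨g, hg⟩, Subgroup.subset_normalClosure rfl, rfl⟩) ha)
  by_contra hlt
  -- A visit to the ball with noncontractible image would split `h` into two long factors.
  have hvisit : ∀ L, L <:+ h.toWord → ∀ p : FreeGroup ι, p.norm ≤ g.norm →
      (mk L : FreeGroup ι ⧸ H) = p → θ (mk L) (1 : FreeGroup ι) = 1 := by
    rintro L ⟨M, hM⟩ p hp hc
    by_contra hne
    have hu : p⁻¹ * mk L ∈ H := QuotientGroup.eq.1 hc.symm
    have hθu : θ (p⁻¹ * mk L) (1 : FreeGroup ι) ≠ 1 := by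
      intro h1
      apply hne
      rw [← mul_inv_cancel_left p (mk L), hθ.mul_of_mem p hu, h1, hθ.of_norm_le hp, one_mul]
    have hfac : mk M * p * (p⁻¹ * mk L) = h := by
      rw [mul_assoc, mul_inv_cancel_left, mul_mk, hM, mk_toWord]
    have hv : mk M * p ∈ H := (H.mul_mem_cancel_right hu).1 (hfac ▸ hhH)
    have hθv : θ (mk M * p) (1 : FreeGroup ι) ≠ 1 := by
      intro h1
      apply hθu
      rw [← hker h hh, ← hfac, hθ.mul_of_mem _ hu, h1, one_mul]
    have e1 := hD _ hu fun hz => hθu (hzp _ hz)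
    have e2 := hD _ hv fun hz => hθv (hzp _ hz)
    have e3 := norm_mul_le p⁻¹ (mk L)
    have e4 := norm_mul_le (mk M) p
    rw [norm_inv_eq] at e3
    have e5 : (mk L).norm ≤ L.length := norm_mk_le
    have e6 : (mk M).norm ≤ M.length := norm_mk_le
    have e7 : h.norm = M.length + L.length := by rw [norm, ← hM, List.length_append]
    omega
  rcases hθ.path_dichotomy hg hshort' h.toWord isReduced_toWord hvisit with
    ⟨p, z, hp, hz, hpz⟩ | ⟨hout, -⟩
  · rw [mk_toWord] at hpz
    have hpH : p ∈ H := (H.mul_mem_cancel_right (hgH hz)).1 (hpz ▸ hhH)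
    exact hhg (hpz ▸ mul_mem (hshort' p hpH (by omega)) hz)
  · refine hout 1 (by simp) ?_
    rw [mk_toWord]
    exact (QuotientGroup.eq.2 (by simpa using hhH)).symm

end FreeGroup

/-! ### The Magnus representation and short elements -/

/-- A function on words, read as the noncommutative formal power series over `ℤ` whose coefficient
at the monomial `l` is `f l`. -/
abbrev WordSeries (ι : Type*) : Type _ := List ι → ℤ

namespace WordSeries

variable {ι : Type*}

/-- The ideal of power series without terms of degree less than `k`. -/
def order (ι : Type*) (k : ℕ) : Submodule ℤ (WordSeries ι) where
  carrier := {f | ∀ l, l.length < k → f l = 0}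
  add_mem' ha hb l hl := by simp [ha l hl, hb l hl]
  zero_mem' _ _ := rfl
  smul_mem' c f hf l hl := by simp [hf l hl]

theorem order_anti {j k : ℕ} (h : j ≤ k) : order ι k ≤ order ι j :=
  fun _ hf l hl => hf l (hl.trans_le h)

open Classical in
/-- The coefficients of `(1 + X_x) f`. -/
noncomputable def mulOneAdd (x : ι) (f : WordSeries ι) : WordSeries ι
  | [] => f []
  | i :: l => f (i :: l) + if i = x then f l else 0

open Classical in
/-- The coefficients of `(1 + X_x)⁻¹ f`. -/
noncomputable def mulOneAddInv (x : ι) (f : WordSeries ι) : WordSeries ι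
  | [] => f []
  | i :: l => f (i :: l) - if i = x then mulOneAddInv x f l else 0

/-- Multiplication by `1 + X_x` from the left, as an automorphism. -/
noncomputable def mulOneAddEquiv (x : ι) : WordSeries ι ≃ₗ[ℤ] WordSeries ι where
  toFun := mulOneAdd x
  invFun := mulOneAddInv x
  map_add' f f' := by
    ext l
    cases l with
    | nil => rfl
    | cons i l => by_cases h : i = x <;> simp [mulOneAdd, h] ; ring
  map_smul' c f := by
    ext l
    cases l with
    | nil => rfl
    | cons i l => by_cases h : i = x <;> simp [mulOneAdd, h] ; ring
  left_inv f := by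
    ext l
    induction l with
    | nil => rfl
    | cons i l ih => by_cases h : i = x <;> simp_all [mulOneAdd, mulOneAddInv]
  right_inv f := by
    ext l
    cases l with
    | nil => rfl
    | cons i l => by_cases h : i = x <;> simp [mulOneAdd, mulOneAddInv, h]

/-- The Magnus representation: the generator `x` acts as multiplication by `1 + X_x`. -/
noncomputable def magnus (ι : Type*) : FreeGroup ι →* (WordSeries ι ≃ₗ[ℤ] WordSeries ι) :=
  FreeGroup.lift mulOneAddEquiv

theorem magnus_of (x : ι) (f : WordSeries ι) : magnus ι (.of x) f = mulOneAdd x f := by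
  simp [magnus, mulOneAddEquiv]

theorem magnus_of_inv (x : ι) (f : WordSeries ι) :
    magnus ι (.of x)⁻¹ f = mulOneAddInv x f := by
  rw [map_inv, magnus, FreeGroup.lift_apply_of]
  rfl

theorem magnus_mul (a b : FreeGroup ι) (f : WordSeries ι) :
    magnus ι (a * b) f = magnus ι a (magnus ι b f) := by
  rw [map_mul]; rfl

theorem magnus_one (f : WordSeries ι) : magnus ι 1 f = f := by
  rw [map_one]; rfl

theorem magnus_mem_order (w : FreeGroup ι) (k : ℕ) {f : WordSeries ι} (hf : f ∈ order ι k) :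
    magnus ι w f ∈ order ι k := by
  induction w using FreeGroup.induction_on generalizing f with
  | C1 => rwa [magnus_one]
  | of x =>
    intro l hl
    rw [magnus_of]
    cases l with
    | nil => exact hf [] hl
    | cons i l => simp [mulOneAdd, hf _ hl, hf l (by simp at hl; omega)]
  | inv_of x _ =>
    intro l hl
    rw [magnus_of_inv]
    induction l with
    | nil => exact hf [] hl
    | cons i l ih => simp [mulOneAddInv, hf _ hl, ih (by simp at hl; omega)]
  | mul a b iha ihb =>
    rw [magnus_mul]
    exact iha (ihb hf)

/-- The `n`-th dimension subgroup over `ℤ`: the elements `w` such that `w - 1` raises the order of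
every power series by at least `n`. -/
def dimSubgroup (ι : Type*) (n : ℕ) : Subgroup (FreeGroup ι) where
  carrier := {w | ∀ k, ∀ f ∈ order ι k, magnus ι w f - f ∈ order ι (k + n)}
  one_mem' k f hf := by simp
  mul_mem' {a b} ha hb k f hf := by
    rw [magnus_mul, ← sub_add_sub_cancel _ (magnus ι b f)]
    exact add_mem (ha k _ (magnus_mem_order b k hf)) (hb k f hf)
  inv_mem' {a} ha k f hf := by
    have h : magnus ι a⁻¹ f - f = - magnus ι a⁻¹ (magnus ι a f - f) := by
      rw [map_sub, ← magnus_mul, inv_mul_cancel, magnus_one]; abel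
    rw [h]
    exact neg_mem (magnus_mem_order _ _ (ha k f hf))

theorem dimSubgroup_anti {m n : ℕ} (h : m ≤ n) : dimSubgroup ι n ≤ dimSubgroup ι m :=
  fun _ hw k f hf => order_anti (by omega) (hw k f hf)

theorem dimSubgroup_one : dimSubgroup ι 1 = ⊤ := by
  rw [eq_top_iff, ← FreeGroup.closure_range_of, Subgroup.closure_le]
  rintro _ ⟨x, rfl⟩ k f hf l hl
  rw [magnus_of]
  cases l with
  | nil => simp [mulOneAdd]
  | cons i l => simp [mulOneAdd, hf l (by simp at hl; omega)]

theorem commutator_mem_dimSubgroup {a b : ℕ} {u w : FreeGroup ι} (hu : u ∈ dimSubgroup ι a)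
    (hw : w ∈ dimSubgroup ι b) : u * w * u⁻¹ * w⁻¹ ∈ dimSubgroup ι (a + b) := by
  intro k f hf
  -- With `f = w u f'`, the commutator minus one maps `f` to `(uw - wu) f'`.
  obtain ⟨f', hf', rfl⟩ : ∃ f' ∈ order ι k, magnus ι (w * u) f' = f :=
    ⟨magnus ι (w * u)⁻¹ f, magnus_mem_order _ _ hf, by
      rw [← magnus_mul, mul_inv_cancel, magnus_one]⟩
  have h : magnus ι (u * w * u⁻¹ * w⁻¹) (magnus ι (w * u) f') - magnus ι (w * u) f' =
      (magnus ι u (magnus ι w f' - f') - (magnus ι w f' - f')) -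
      (magnus ι w (magnus ι u f' - f') - (magnus ι u f' - f')) := by
    rw [← magnus_mul, show u * w * u⁻¹ * w⁻¹ * (w * u) = u * w by group]
    simp only [map_sub, magnus_mul]
    abel
  rw [h]
  refine sub_mem ?_ ?_
  · exact order_anti (by omega) (hu _ _ (hw _ _ hf'))
  · exact order_anti (by omega) (hw _ _ (hu _ _ hf'))

instance dimSubgroup_normal (n : ℕ) : (dimSubgroup ι n).Normal where
  conj_mem w hw u := by
    have hu : u ∈ dimSubgroup ι 1 := dimSubgroup_one ▸ Subgroup.mem_top u
    have := mul_mem (dimSubgroup_anti (Nat.le_add_left n 1) (commutator_mem_dimSubgroup hu hw)) hw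
    simpa using this

theorem magnus_pow_sub_mem {n : ℕ} {r : FreeGroup ι} (hr : r ∈ dimSubgroup ι n) (j k : ℕ)
    {f : WordSeries ι} (hf : f ∈ order ι k) :
    magnus ι (r ^ j) f - f - (j : ℤ) • (magnus ι r f - f) ∈ order ι (k + n + n) := by
  induction j with
  | zero => simp
  | succ j ih =>
    have h : magnus ι (r ^ (j + 1)) f - f - ((j + 1 : ℕ) : ℤ) • (magnus ι r f - f) =
        (magnus ι (r ^ j) f - f - (j : ℤ) • (magnus ι r f - f)) +
        (magnus ι (r ^ j) (magnus ι r f - f) - (magnus ι r f - f)) := by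
      rw [pow_succ, magnus_mul, map_sub, Nat.cast_succ, add_smul, one_smul]
      abel
    rw [h]
    exact add_mem ih (pow_mem hr j _ _ (hr _ _ hf))

/-- The quotient of a free group by a dimension subgroup is torsion-free: modulo higher order,
`r ^ j - 1` is `j` times `r - 1`. -/
theorem mem_dimSubgroup_of_pow_mem {r : FreeGroup ι} {j : ℕ} (hj : j ≠ 0) (N : ℕ)
    (h : r ^ j ∈ dimSubgroup ι (N + 1)) : r ∈ dimSubgroup ι (N + 1) := by
  induction N with
  | zero => exact dimSubgroup_one (ι := ι) ▸ Subgroup.mem_top r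
  | succ N ih =>
    have hr := ih (dimSubgroup_anti (Nat.le_succ _) h)
    intro k f hf l hl
    have h1 := magnus_pow_sub_mem hr j k hf l (by omega)
    have h2 := h k f hf l hl
    simp only [Pi.sub_apply, Pi.smul_apply, smul_eq_mul] at h1 h2 ⊢
    rw [h2, zero_sub, neg_eq_zero] at h1
    exact (mul_eq_zero.1 h1).resolve_left (by exact_mod_cast hj)

theorem mem_dimSubgroup_of_zpow_mem {r : FreeGroup ι} {j : ℤ} (hj : j ≠ 0) (N : ℕ)
    (h : r ^ j ∈ dimSubgroup ι (N + 1)) : r ∈ dimSubgroup ι (N + 1) := by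
  refine mem_dimSubgroup_of_pow_mem (Int.natAbs_ne_zero.2 hj) N ?_
  rcases Int.natAbs_eq j with h' | h' <;> rw [h'] at h
  · rwa [zpow_natCast] at h
  · rwa [zpow_neg, zpow_natCast, inv_mem_iff] at h

/-- The action of a letter on the coefficients at words without equal adjacent letters. -/
theorem magnus_letter (x : ι) (b : Bool) (f : WordSeries ι) {l : List ι}
    (hl : (x :: l).IsChain (· ≠ ·)) :
    magnus ι (.mk [(x, b)]) f l = f l ∧
    magnus ι (.mk [(x, b)]) f (x :: l) = f (x :: l) + (if b then 1 else -1) * f l := by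
  have h1 : mulOneAdd x f l = f l ∧ mulOneAddInv x f l = f l := by
    cases l with
    | nil => exact ⟨rfl, rfl⟩
    | cons i l =>
      have : i ≠ x := (List.isChain_cons_cons.1 hl).1.symm
      simp [mulOneAdd, mulOneAddInv, this]
  cases b
  · have : FreeGroup.mk [(x, false)] = (FreeGroup.of x)⁻¹ := rfl
    rw [this, magnus_of_inv]
    exact ⟨h1.2, by simp [mulOneAddInv, h1.2]; ring⟩
  · have : FreeGroup.mk [(x, true)] = FreeGroup.of x := rfl
    rw [this, magnus_of]
    exact ⟨h1.1, by simp [mulOneAdd]⟩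

/-- The constant power series `1`. -/
def one (ι : Type*) : WordSeries ι
  | [] => 1
  | _ :: _ => 0

/-- Let `x :: l` list the letters of the syllables of a reduced word `(x, b) :: L`. The coefficient
of its Magnus series at `x :: l` does not vanish. For an induction on the word, its sign is
recorded relative to that of the coefficient at `l`, together with the vanishing of the coefficients
at longer words without equal adjacent letters. -/
theorem exists_magnus_coeff_ne_zero (L : List (ι × Bool)) (x : ι) (b : Bool)
    (hL : FreeGroup.IsReduced ((x, b) :: L)) :
    ∃ l : List ι, (x :: l).IsChain (· ≠ ·) ∧ l.length ≤ L.length ∧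
      0 < (if b then 1 else -1) * magnus ι (.mk ((x, b) :: L)) (one ι) (x :: l) *
        magnus ι (.mk ((x, b) :: L)) (one ι) l ∧
      ∀ m : List ι, (x :: m).IsChain (· ≠ ·) → l.length < m.length →
        magnus ι (.mk ((x, b) :: L)) (one ι) m = 0 ∧
        magnus ι (.mk ((x, b) :: L)) (one ι) (x :: m) = 0 := by
  induction L generalizing x b with
  | nil =>
    refine ⟨[], List.isChain_singleton x, le_rfl, ?_, ?_⟩
    · obtain ⟨h1, h2⟩ := magnus_letter x b (one ι) (List.isChain_singleton x)
      rw [h1, h2]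
      cases b <;> simp [one]
    · intro m hm hlen
      obtain ⟨h1, h2⟩ := magnus_letter x b (one ι) hm
      cases m with
      | nil => simp at hlen
      | cons i m => rw [h1, h2]; simp [one]
  | cons a L ih =>
    obtain ⟨y, c⟩ := a
    obtain ⟨hxy, hL'⟩ := FreeGroup.isReduced_cons_cons.1 hL
    obtain ⟨l, hl, hlen, hpos, hzero⟩ := ih y c hL'
    have hmk : FreeGroup.mk ((x, b) :: (y, c) :: L) = .mk [(x, b)] * .mk ((y, c) :: L) := by
      rw [FreeGroup.mul_mk]; rfl
    rw [hmk]
    simp only [magnus_mul]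
    generalize magnus ι (.mk ((y, c) :: L)) (one ι) = f at *
    by_cases h : x = y
    · -- The first syllable grows: the coefficient at `x :: l` moves by `±f l`, away from zero.
      subst h
      obtain rfl : b = c := hxy rfl
      refine ⟨l, hl, hlen.trans (by simp), ?_, ?_⟩
      · obtain ⟨h1, h2⟩ := magnus_letter x b f hl
        rw [h1, h2]
        have h3 : f l ≠ 0 := by rintro h0; simp [h0] at hpos
        have h4 : 0 < f l * f l := mul_self_pos.2 h3
        cases b <;> simp at hpos ⊢ <;> nlinarith
      · intro m hm hml
        obtain ⟨h1, h2⟩ := magnus_letter x b f hm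
        obtain ⟨h3, h4⟩ := hzero m hm hml
        rw [h1, h2, h3, h4]
        simp
    · -- A new syllable begins, so that the coefficient at `x :: y :: l` is `±f (y :: l)`.
      have hvan : ∀ m : List ι, m.IsChain (· ≠ ·) → (y :: l).length < m.length → f m = 0 := by
        intro m hm hml
        cases m with
        | nil => simp at hml
        | cons i m =>
          by_cases hi : i = y
          · subst hi
            exact (hzero m hm (by simpa using hml)).2
          · exact (hzero (i :: m) (List.isChain_cons_cons.2 ⟨Ne.symm hi, hm⟩)
              (by simp at hml ⊢; omega)).1
      have hl' : (x :: y :: l).IsChain (· ≠ ·) := List.isChain_cons_cons.2 ⟨h, hl⟩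
      refine ⟨y :: l, hl', by simpa using hlen, ?_, ?_⟩
      · obtain ⟨h1, h2⟩ := magnus_letter x b f hl'
        rw [h1, h2, hvan _ hl' (by simp)]
        have h3 : f (y :: l) ≠ 0 := by rintro h0; simp [h0] at hpos
        have h4 : 0 < f (y :: l) * f (y :: l) := mul_self_pos.2 h3
        cases b <;> simp <;> nlinarith
      · intro m hm hml
        obtain ⟨h1, h2⟩ := magnus_letter x b f hm
        rw [h1, h2, hvan m hm.tail hml, hvan _ hm (by simp at hml ⊢; omega)]
        simp

theorem eq_one_of_mem_dimSubgroup [DecidableEq ι] {w : FreeGroup ι} {n : ℕ}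
    (hn : w.norm < n) (hw : w ∈ dimSubgroup ι n) : w = 1 := by
  by_contra h
  obtain ⟨⟨x, b⟩, L, hL⟩ := List.exists_cons_of_ne_nil (mt FreeGroup.toWord_eq_nil_iff.1 h)
  obtain ⟨l, -, hlen, hpos, -⟩ := exists_magnus_coeff_ne_zero L x b (hL ▸ FreeGroup.isReduced_toWord)
  rw [← hL, FreeGroup.mk_toWord] at hpos
  have h0 := hw 0 (one ι) (fun l hl => by simp at hl) (x :: l) (by
    rw [FreeGroup.norm, hL] at hn; simp at hn ⊢; omega)
  simp only [Pi.sub_apply, one, sub_zero] at h0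
  simp [h0] at hpos

theorem subnormalClosure_le_sup_dimSubgroup (g : FreeGroup ι) (ℓ : ℕ) :
    subnormalClosure {g} ℓ ≤ Subgroup.zpowers g ⊔ dimSubgroup ι (ℓ + 1) := by
  induction ℓ with
  | zero => simp [dimSubgroup_one]
  | succ ℓ ih =>
    have hg : g ∈ Subgroup.zpowers g ⊔ dimSubgroup ι (ℓ + 1 + 1) :=
      Subgroup.mem_sup_left (Subgroup.mem_zpowers g)
    refine normalClosureIn_le ?_ ?_
    · rintro x ⟨rfl, -⟩
      exact hg
    · intro a ha n hn
      obtain ⟨z, hz, d, hd, rfl⟩ := Subgroup.mem_sup_of_normal_right.1 (ih ha)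
      obtain ⟨z', ⟨j, rfl⟩, d', hd', rfl⟩ := Subgroup.mem_sup_of_normal_right.1 hn
      have hg1 : g ^ j ∈ dimSubgroup ι 1 := dimSubgroup_one (ι := ι) ▸ Subgroup.mem_top _
      have hc := Subgroup.mem_sup_right (S := Subgroup.zpowers g)
        (commutator_mem_dimSubgroup hd hg1)
      have hd1 := Subgroup.mem_sup_right (S := Subgroup.zpowers g)
        ((dimSubgroup_normal (ι := ι) (ℓ + 1 + 1)).conj_mem d' hd' d)
      have hz1 : z ∈ Subgroup.zpowers g ⊔ dimSubgroup ι (ℓ + 1 + 1) := Subgroup.mem_sup_left hz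
      have := mul_mem (mul_mem hz1 (mul_mem (mul_mem hc (zpow_mem hg j)) hd1)) (inv_mem hz1)
      convert this using 1
      simp only
      group

/-- The short elements of deep subnormal closures of `g` are powers of `g`. For such an
element `h`, the commutator of `h` and `g` is short and lies deep in the filtration, so `h`
commutes with `g`; both are then powers of some `r`, and the torsion-freeness of the quotients
compares the exponents. -/
theorem mem_zpowers_of_norm_le [DecidableEq ι] {g h : FreeGroup ι} {C ℓ : ℕ} (hg : g.norm ≤ C)
    (hh : h.norm ≤ C) (hℓ : 4 * C ≤ ℓ) (hmem : h ∈ subnormalClosure {g} ℓ) :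
    h ∈ Subgroup.zpowers g := by
  obtain ⟨z, ⟨k, rfl⟩, d, hd, rfl⟩ :=
    Subgroup.mem_sup_of_normal_right.1 (subnormalClosure_le_sup_dimSubgroup g ℓ hmem)
  simp only at *
  have hg1 : g ∈ dimSubgroup ι 1 := dimSubgroup_one (ι := ι) ▸ Subgroup.mem_top _
  have hc : Commute g (g ^ k * d) := by
    have h1 : g ^ k * d * g * (g ^ k * d)⁻¹ * g⁻¹ ∈ dimSubgroup ι (ℓ + 1 + 1) := by
      convert (dimSubgroup_normal (ι := ι) (ℓ + 1 + 1)).conj_mem _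
        (commutator_mem_dimSubgroup hd hg1) (g ^ k) using 1
      group
    have h2 := eq_one_of_mem_dimSubgroup ?_ h1
    · exact (mul_inv_eq_iff_eq_mul.1 (mul_inv_eq_one.1 h2)).symm
    · have e1 := FreeGroup.norm_mul_le (g ^ k * d * g * (g ^ k * d)⁻¹) g⁻¹
      have e2 := FreeGroup.norm_mul_le (g ^ k * d * g) (g ^ k * d)⁻¹
      have e3 := FreeGroup.norm_mul_le (g ^ k * d) g
      rw [FreeGroup.norm_inv_eq] at e1 e2
      omega
  obtain ⟨r, ⟨n, hn⟩, ⟨m, hm⟩⟩ := FreeGroup.exists_zpow_of_commute hc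
  simp only at hn hm
  have hr : r ^ (m - n * k) ∈ dimSubgroup ι (ℓ + 1) := by
    have e : m - n * k = -(n * k) + m := by ring
    rwa [e, zpow_add, zpow_neg, zpow_mul, hn, hm, inv_mul_cancel_left]
  by_cases hmk : m - n * k = 0
  · refine ⟨k, ?_⟩
    simp only
    rw [← hm, ← hn, ← zpow_mul]
    congr 1; omega
  · have hr1 := mem_dimSubgroup_of_zpow_mem hmk ℓ hr
    have : g ^ k * d = 1 :=
      eq_one_of_mem_dimSubgroup (n := ℓ + 1) (by omega) (hm ▸ zpow_mem hr1 m)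
    rw [this]
    exact one_mem _

end WordSeries

/-! ### The exponential lower bound -/

/-- From the stage at which all elements of length at most `2 * |g|` have been absorbed into `⟨g⟩`,
the excess over `2 * |g|` of the length of the shortest elements outside `⟨g⟩` doubles. -/
theorem le_norm_of_mem_subnormalClosure {ι : Type*} [DecidableEq ι] (g : FreeGroup ι)
    (k : ℕ) {h : FreeGroup ι} (hh : h ∈ subnormalClosure {g} (8 * g.norm + k))
    (hhg : h ∉ Subgroup.zpowers g) : 2 * g.norm + 2 ^ k ≤ h.norm := by
  induction k generalizing h with
  | zero =>
    by_contra hlt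
    exact hhg (WordSeries.mem_zpowers_of_norm_le (C := 2 * g.norm) (by omega)
      (by simp at hlt; omega) (by omega) hh)
  | succ k ih =>
    have hpos : 0 < 2 ^ k := by positivity
    have := FreeGroup.two_mul_le_norm_of_mem_normalClosureIn (D := 2 * g.norm + 2 ^ k)
      (subset_subnormalClosure {g} (8 * g.norm + k) rfl) (fun a ha hag => ih ha hag)
      (by omega) hh hhg
    rw [pow_succ]
    omega

theorem two_pow_le_basisLength {ι F : Type*} [Group F] (b : FreeGroupBasis ι F) {g h : F} {ℓ : ℕ}
    (hh : h ∈ subnormalClosure {g} ℓ) (hhg : h ∉ Subgroup.zpowers g) :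
    2 ^ ℓ ≤ 2 ^ (8 * basisLength b g) * basisLength b h := by
  classical
  have e : ∀ x : F, basisLength b x = (b.repr x).norm := fun x => by
    unfold basisLength
    congr!
  rw [e, e]
  have hne : b.repr h ∉ Subgroup.zpowers (b.repr g) := by
    rintro ⟨j, hj⟩
    exact hhg ⟨j, b.repr.injective (by simpa using hj)⟩
  have hmem : b.repr h ∈ subnormalClosure {b.repr g} ℓ :=
    map_mem_subnormalClosure b.repr.toMonoidHom g ℓ h hh
  rcases le_total (8 * (b.repr g).norm) ℓ with hℓ | hℓ
  · obtain ⟨k, rfl⟩ := Nat.exists_eq_add_of_le hℓ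
    have := le_norm_of_mem_subnormalClosure (b.repr g) k hmem hne
    rw [pow_add]
    exact Nat.mul_le_mul_left _ (by omega)
  · have hpos : (b.repr h).norm ≠ 0 := fun h0 =>
      hne (FreeGroup.norm_eq_zero.1 h0 ▸ one_mem _)
    calc 2 ^ ℓ ≤ 2 ^ (8 * (b.repr g).norm) := Nat.pow_le_pow_right two_pos hℓ
      _ ≤ _ := Nat.le_mul_of_pos_right _ (Nat.pos_of_ne_zero hpos)

theorem theorem2 {ι F : Type*} [Group F] (b : FreeGroupBasis ι F) (g : F) :
    (⨅ ℓ : ℕ, ⨅ _ : 1 ≤ ℓ, subnormalClosure {g} ℓ) = Subgroup.zpowers g ∧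
    ∃ c : ℝ, 0 < c ∧ ∀ ℓ : ℕ, 1 ≤ ℓ →
      ENNReal.ofReal (c * 2 ^ ℓ) ≤ (minLengthOutside b g ℓ : ENNReal) := by
  constructor
  · refine le_antisymm (fun h hh => ?_)
      (le_iInf₂ fun ℓ _ => zpowers_le_subnormalClosure g ℓ)
    by_contra hhg
    simp only [Subgroup.mem_iInf] at hh
    -- An exponent beyond the length of `h` contradicts the exponential lower bound.
    have h1 := two_pow_le_basisLength b
      (hh (8 * basisLength b g + (basisLength b h + 1)) (by omega)) hhg
    rw [pow_add] at h1
    have h2 := Nat.le_of_mul_le_mul_left h1 (by positivity)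
    have h3 := Nat.lt_two_pow_self (n := basisLength b h + 1)
    omega
  · refine ⟨(2 ^ (8 * basisLength b g))⁻¹, by positivity, fun ℓ _ => ?_⟩
    have key : ∀ n : ℕ, 2 ^ ℓ ≤ 2 ^ (8 * basisLength b g) * n →
        ENNReal.ofReal ((2 ^ (8 * basisLength b g))⁻¹ * 2 ^ ℓ) ≤ ((n : ℕ∞) : ENNReal) := by
      intro n hn
      rw [ENat.toENNReal_coe, ← ENNReal.ofReal_natCast n]
      refine ENNReal.ofReal_le_ofReal ?_
      rw [inv_mul_le_iff₀ (by positivity)]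
      exact_mod_cast hn
    rcases eq_or_ne (minLengthOutside b g ℓ) ⊤ with htop | htop
    · simp [htop]
    · -- A finite infimum of natural numbers is attained.
      obtain ⟨n, hn⟩ := ENat.ne_top_iff_exists.1 htop
      have hlt : minLengthOutside b g ℓ < (n + 1 : ℕ) := by
        rw [← hn]; exact_mod_cast Nat.lt_succ_self n
      obtain ⟨h, hlt⟩ := iInf_lt_iff.1 hlt
      obtain ⟨⟨hh, hhg⟩, hlt⟩ := iInf_lt_iff.1 hlt
      have hle : basisLength b h ≤ n := by
        have : basisLength b h < n + 1 := by exact_mod_cast hlt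
        omega
      rw [← hn]
      exact key n ((two_pow_le_basisLength b hh hhg).trans (Nat.mul_le_mul_left _ hle))
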